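/- Let $n\ge 3$ and $d\ge 0$ be integers and let $G$ be a finite simple graph that is $d$-degenerate, i.e. every nonempty induced subgraph of $G$ has a vertex of degree at most $d$ in that subgraph. Then $$\mathrm{ch}^e_\Sigma(G\,\Box\,K_n)\le nd+3 .$$ Here $G\,\Box\,K_n$ is the Cartesian product of $G$ with the complete graph on $n$ vertices. For a finite simple graph $H$, $\mathrm{ch}^e_\Sigma(H)$ is the smallest nonnegative integer $k$ such that, for every assignment of a set $L_e$ of $k$ real numbers to each edge $e$ of $H$, there are weights $w(e)\in L_e$ with $\sum_{e\ni u}w(e)\neq\sum_{e\ni v}w(e)$ for every two adjacent vertices $u,v$ of $H$ (and $\mathrm{ch}^e_\Sigma(H)=\infty$ if no such $k$ exists). -/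

import Mathlib

namespace SimpleGraph

/-- `G` is `d`-degenerate: every (nonempty) induced subgraph of `G` has a vertex whose degree in
that subgraph is at most `d`. -/
def IsDegenerate {V : Type*} (G : SimpleGraph V) (d : ℕ) : Prop :=
  ∀ S : Set V, S.Nonempty → ∃ v : S, ((G.induce S).neighborSet v).encard ≤ (d : ℕ∞)

open Classical in
/-- The colour `∑_{e ∋ v} w(e)` of the vertex `v` under an edge weighting `w`. -/
noncomputable def weightSum {V : Type*} [Fintype V] (G : SimpleGraph V)
    (w : G.edgeSet → ℝ) (v : V) : ℝ :=
  ∑ e ∈ Finset.univ.filter (fun e : G.edgeSet => v ∈ e.val), w e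

/-- `w` is a vertex colouring by sums: adjacent vertices have different sums of incident
edge weights. -/
def IsColouringBySums {V : Type*} [Fintype V] (G : SimpleGraph V) (w : G.edgeSet → ℝ) : Prop :=
  ∀ u v : V, G.Adj u v → G.weightSum w u ≠ G.weightSum w v

/-- Every assignment of lists of `k` real numbers to the edges of `G` permits a choice of one
weight from each list that is a vertex colouring by sums. -/
def IsEdgeWeightChoosable {V : Type*} [Fintype V] (G : SimpleGraph V) (k : ℕ) : Prop :=
  ∀ L : G.edgeSet → Finset ℝ, (∀ e, (L e).card = k) →
    ∃ w : G.edgeSet → ℝ, (∀ e, w e ∈ L e) ∧ G.IsColouringBySums w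

/-- The edge weight choosability number: the smallest `k` for which `G` is edge weight
`k`-choosable, and `⊤` if there is no such `k`. -/
noncomputable def edgeWeightChoosability {V : Type*} [Fintype V] (G : SimpleGraph V) : ℕ∞ :=
  ⨅ (k : ℕ) (_ : G.IsEdgeWeightChoosable k), (k : ℕ∞)

end SimpleGraph

/-!
The copies of `Kₙ` in `G □ Kₙ` are treated one after another, in an order in which every vertex of
`G` has at most `d` neighbours among the earlier ones. If the weights of the edges inside one copy
are changed, only the sums at its `n` vertices change, so the inductive step
(`SimpleGraph.exists_forall_weightSum_ne`) is a statement about a single complete graph: for lists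
of size `n * d + 3` and arbitrary constants added to the vertex sums, the sums can be made distinct
while each of them avoids `d` given values (`exists_weights_cliqueSum`).

This is proved by the Combinatorial Nullstellensatz. Let `S i` be the sum of the variables on the
edges at `i`. It has to be shown that the form `∏ (S i - S j) * ∏ (S i) ^ d i`, where `d i ≤ d`,
contains a monomial with all exponents at most `n * d + 2`. The first factor is invariant under
adding the same `W` to all variables, while each `S i` grows by `(n - 1) * W`; so the coefficient of
the highest power of `W` after this substitution is a nonzero multiple of the first factor, and
undoing the substitution raises each exponent by at most `∑ d i ≤ n * d`
(`exists_coeff_cliquePoly_mul_prod_ne_zero`). What remains is that `∏ (S i - S j)` contains a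
monomial with all exponents at most two (`hasSmallMonomial`). This is done by adding two vertices at
a time, starting from one vertex and from four vertices: the product vanishes for two vertices.

Monomials are tracked through such substitutions by
`MvPolynomial.exists_coeff_ne_zero_of_coeff_aeval_ne_zero`, and coefficients of products are
isolated by `MvPolynomial.exists_coeff_mul_ne_zero_of_supported`.
-/

section

open MvPolynomial

/-! ### Monomials of polynomials under substitution -/

/-- Suppose that every monomial of `x e` involves a variable of `T e`. A monomial `b` of the
polynomial obtained from `F` by substituting `x e` for each variable `e` comes from a monomial `m`
of `F`; each of the `m e` factors `x e` uses up a variable of `T e`, whence the bound on `m e`. -/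
theorem MvPolynomial.exists_coeff_ne_zero_of_coeff_aeval_ne_zero {σ τ R : Type*} [CommRing R]
    (x : σ → MvPolynomial τ R) (T : σ → Finset τ)
    (hx : ∀ e, ∀ p ∈ (x e).support, 1 ≤ ∑ t ∈ T e, p t)
    {F : MvPolynomial σ R} {b : τ →₀ ℕ} (hb : coeff b (aeval x F) ≠ 0) :
    ∃ m, coeff m F ≠ 0 ∧ ∀ e, m e ≤ ∑ t ∈ T e, b t := by
  classical
  have hmul : ∀ (S : Finset τ) (k l : ℕ) (f g : MvPolynomial τ R),
      (∀ p ∈ f.support, k ≤ ∑ t ∈ S, p t) → (∀ p ∈ g.support, l ≤ ∑ t ∈ S, p t) →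
      ∀ p ∈ (f * g).support, k + l ≤ ∑ t ∈ S, p t := by
    intro S k l f g hf hg p hp
    obtain ⟨q, hq, r, hr, rfl⟩ := Finset.mem_add.1 (support_mul f g hp)
    simpa [Finset.sum_add_distrib] using add_le_add (hf q hq) (hg r hr)
  have hpow : ∀ e k, ∀ p ∈ (x e ^ k).support, k ≤ ∑ t ∈ T e, p t := by
    intro e k
    induction k with
    | zero => simp
    | succ k ih => rw [pow_succ]; exact hmul _ _ _ _ _ ih (hx e)
  rw [aeval_def, eval₂_eq, coeff_sum] at hb
  obtain ⟨m, hm, hne⟩ := Finset.exists_ne_zero_of_sum_ne_zero hb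
  refine ⟨m, mem_support_iff.1 hm, fun e => ?_⟩
  by_cases he : e ∈ m.support
  · rw [← Finset.mul_prod_erase _ _ he, mul_left_comm] at hne
    simpa using hmul (T e) (m e) 0 _ _ (hpow e (m e)) (by simp) b (mem_support_iff.2 hne)
  · simp [Finsupp.notMem_support_iff.1 he]

/-- The case of `exists_coeff_ne_zero_of_coeff_aeval_ne_zero` in which the variables outside `T`
are set to zero. -/
theorem MvPolynomial.exists_coeff_ne_zero_of_coeff_restrict_ne_zero {τ R : Type*} [CommRing R]
    (T : Set τ) [DecidablePred (· ∈ T)] {F : MvPolynomial τ R} {b : τ →₀ ℕ}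
    (hb : coeff b (aeval (fun t => if t ∈ T then (X t : MvPolynomial τ R) else 0) F) ≠ 0) :
    ∃ m, coeff m F ≠ 0 ∧ ∀ t, m t ≤ if t ∈ T then b t else 0 := by
  classical
  nontriviality R
  obtain ⟨m, hm, hmb⟩ := exists_coeff_ne_zero_of_coeff_aeval_ne_zero
    (fun t => if t ∈ T then (X t : MvPolynomial τ R) else 0) (fun t => if t ∈ T then {t} else ∅)
    (by
      intro t p hp
      by_cases ht : t ∈ T
      · simp only [ht, if_true, support_X, Finset.mem_singleton] at hp
        simp [ht, hp]
      · simp [ht] at hp) hb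
  refine ⟨m, hm, fun t => (hmb t).trans_eq ?_⟩
  by_cases ht : t ∈ T <;> simp [ht]

theorem MvPolynomial.coeff_eq_zero_of_mem_supported {τ R : Type*} [CommRing R] {T : Set τ}
    {P : MvPolynomial τ R} (hP : P ∈ supported R Tᶜ) {p : τ →₀ ℕ} {t : τ} (ht : t ∈ T)
    (hp : p t ≠ 0) : coeff p P = 0 := by
  by_contra h
  exact mem_supported.1 hP (mem_vars_iff_mem_support t |>.2 ⟨p, mem_support_iff.2 h,
    Finsupp.mem_support_iff.2 hp⟩) ht

/-- Let `P` be free of the variables in `T`, let `Q` be homogeneous, and let `b` be a monomial of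
what remains of `Q` when the variables outside `T` are set to zero. Then the product of a monomial
of `P` with the monomial of `Q` underlying `b` arises in `P * Q` in only one way, because all
monomials of `Q` have the same degree. In terms of permanents, this is expansion along a block
triangular matrix. -/
theorem MvPolynomial.exists_coeff_mul_ne_zero_of_supported {τ R : Type*} [CommRing R] [IsDomain R]
    (T : Set τ) [DecidablePred (· ∈ T)]
    {P Q : MvPolynomial τ R} {N : ℕ} (hP : P ∈ supported R Tᶜ) (hQ : Q.IsHomogeneous N)
    {a b : τ →₀ ℕ} (ha : coeff a P ≠ 0)
    (hb : coeff b (aeval (fun t => if t ∈ T then (X t : MvPolynomial τ R) else 0) Q) ≠ 0) :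
    ∃ c, coeff c (P * Q) ≠ 0 ∧ ∀ t, c t ≤ if t ∈ T then b t else a t := by
  classical
  obtain ⟨m, hm, hmb⟩ := exists_coeff_ne_zero_of_coeff_restrict_ne_zero T hb
  have hP' : ∀ p, coeff p P ≠ 0 → ∀ t ∈ T, p t = 0 := fun p hp t ht =>
    not_imp_comm.1 (coeff_eq_zero_of_mem_supported hP ht) hp
  have hmT : ∀ t ∉ T, m t = 0 := fun t ht => by simpa [ht] using hmb t
  refine ⟨a + m, ?_, fun t => ?_⟩
  · rw [coeff_mul, Finset.sum_eq_single (a, m)]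
    · exact mul_ne_zero ha hm
    · rintro ⟨p, q⟩ hpq hne
      by_contra h
      have hp := left_ne_zero_of_mul h
      have hq := right_ne_zero_of_mul h
      rw [Finset.HasAntidiagonal.mem_antidiagonal] at hpq
      have hmq : m ≤ q := by
        intro t
        have := DFunLike.congr_fun hpq t
        simp only [Finsupp.add_apply] at this
        by_cases ht : t ∈ T
        · rw [hP' p hp t ht, hP' a ha t ht] at this
          omega
        · simp [hmT t ht]
      -- `q` and `m` have the same degree, so `m ≤ q` forces equality.
      have hd : q.degree = m.degree := by
        rw [not_imp_comm.1 hQ.coeff_eq_zero hq, not_imp_comm.1 hQ.coeff_eq_zero hm]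
      obtain ⟨r, rfl⟩ := exists_add_of_le hmq
      have hr : r = 0 := by
        rw [← Finsupp.degree_eq_zero_iff]
        have := map_add Finsupp.degree m r
        omega
      subst hr
      apply hne
      simpa using hpq
    · intro h
      simp at h
  · by_cases ht : t ∈ T
    · simpa [ht, hP' a ha t ht] using hmb t
    · simp [ht, hmT t ht]

theorem MvPolynomial.coeff_sum_X_pow_ne_zero {σ R : Type*} [CommRing R] [CharZero R]
    (s : Finset σ) (m : σ →₀ ℕ) (hm : m.support ⊆ s) :
    coeff m ((∑ i ∈ s, (X i : MvPolynomial σ R)) ^ m.degree) ≠ 0 := by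
  classical
  have h : (∑ i ∈ s, (X i : MvPolynomial σ R)) =
      Finsupp.linearCombination R X (Finsupp.indicator s fun _ _ => (1 : R)) := by
    rw [Finsupp.linearCombination_apply,
      Finsupp.sum_of_support_subset _ (Finsupp.support_indicator_subset s _) _ (by simp)]
    exact Finset.sum_congr rfl fun i hi => by simp [Finsupp.indicator_of_mem hi]
  rw [h, coeff_linearCombination_X_pow, if_pos (by simp [Finsupp.degree_apply, Finsupp.sum])]
  rw [Finsupp.prod, Finset.prod_eq_one, mul_one]
  · exact Nat.cast_ne_zero.2 (Nat.multinomial_pos _ _).ne'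
  · intro i hi
    simp [Finsupp.indicator_of_mem (hm hi)]

/-! ### Leading forms and the Combinatorial Nullstellensatz -/

/-- `F` is the part of `f` of degree `N`, and `f` has no part of larger degree. The form `F` may
be zero, so that `f` need not have degree exactly `N`. -/
structure MvPolynomial.IsLeadingForm {σ R : Type*} [CommRing R] (f F : MvPolynomial σ R) (N : ℕ) :
    Prop where
  isHomogeneous : F.IsHomogeneous N
  coeff_eq : ∀ m : σ →₀ ℕ, N ≤ m.degree → MvPolynomial.coeff m f = MvPolynomial.coeff m F

namespace MvPolynomial.IsLeadingForm
variable {σ R : Type*} [CommRing R]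

theorem mul {f F g G : MvPolynomial σ R} {M N : ℕ} (hf : IsLeadingForm f F M)
    (hg : IsLeadingForm g G N) : IsLeadingForm (f * g) (F * G) (M + N) := by
  classical
  refine ⟨hf.1.mul hg.1, fun m hm => ?_⟩
  rw [coeff_mul, coeff_mul]
  refine Finset.sum_congr rfl ?_
  -- If one of the two degrees is too small, the other is too large and both summands vanish.
  rintro ⟨p, q⟩ hpq
  rw [Finset.HasAntidiagonal.mem_antidiagonal] at hpq
  have hdeg : p.degree + q.degree = m.degree := by rw [← map_add, hpq]
  dsimp only
  rcases lt_or_ge p.degree M with hp | hp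
  · have hq : N < q.degree := by omega
    rw [hg.2 q hq.le, hg.1.coeff_eq_zero hq.ne', mul_zero, mul_zero]
  · rcases lt_or_ge q.degree N with hq | hq
    · have hp : M < p.degree := by omega
      rw [hf.2 p hp.le, hf.1.coeff_eq_zero hp.ne', zero_mul, zero_mul]
    · rw [hf.2 p hp, hg.2 q hq]

theorem prod {ι : Type*} (s : Finset ι) {f F : ι → MvPolynomial σ R} {N : ι → ℕ}
    (h : ∀ i ∈ s, IsLeadingForm (f i) (F i) (N i)) :
    IsLeadingForm (∏ i ∈ s, f i) (∏ i ∈ s, F i) (∑ i ∈ s, N i) := by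
  classical
  induction s using Finset.induction_on with
  | empty => simpa using ⟨isHomogeneous_one σ R, fun _ _ => rfl⟩
  | insert i s hi ih =>
    rw [Finset.prod_insert hi, Finset.prod_insert hi, Finset.sum_insert hi]
    exact (h i (Finset.mem_insert_self i s)).mul
      (ih fun j hj => h j (Finset.mem_insert_of_mem hj))

theorem add_C {F : MvPolynomial σ R} (hF : F.IsHomogeneous 1) (c : R) :
    IsLeadingForm (F + C c) F 1 := by
  classical
  refine ⟨hF, fun m hm => ?_⟩
  have : (0 : σ →₀ ℕ) ≠ m := by rintro rfl; simp at hm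
  simp [coeff_C, this]

/-- Combinatorial Nullstellensatz, for an arbitrary set of variables and with the hypothesis placed
on the leading form. -/
theorem exists_eval_ne_zero [IsDomain R] {f F : MvPolynomial σ R} {N : ℕ}
    (h : IsLeadingForm f F N) {m : σ →₀ ℕ} (hm : coeff m F ≠ 0) (L : σ → Finset R)
    (hL : ∀ e, m e < (L e).card) : ∃ w : σ → R, (∀ e, w e ∈ L e) ∧ eval w f ≠ 0 := by
  classical
  have hmN : m.degree = N := not_imp_comm.1 h.1.coeff_eq_zero hm
  have hmf : coeff m f ≠ 0 := by rwa [h.2 m hmN.ge]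
  obtain ⟨s, q, rfl⟩ := exists_finset_rename f
  obtain ⟨m, rfl, hq⟩ := coeff_rename_ne_zero _ _ _ hmf
  have hinj : Function.Injective (Subtype.val : {x // x ∈ s} → σ) := Subtype.val_injective
  rw [Finsupp.degree_mapDomain] at hmN
  have hdq : q.totalDegree = m.degree := by
    refine le_antisymm (Finset.sup_le fun p hp => ?_) (le_totalDegree (mem_support_iff.2 hq))
    by_contra hlt
    have hp' : N < (p.mapDomain Subtype.val).degree := by
      rw [Finsupp.degree_mapDomain, ← hmN]; exact not_le.1 hlt
    refine mem_support_iff.1 hp ?_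
    rw [← coeff_rename_mapDomain _ hinj, h.2 _ hp'.le, h.1.coeff_eq_zero hp'.ne']
  obtain ⟨w, hw, hne⟩ := combinatorial_nullstellensatz_exists_eval_nonzero q m hq hdq
    (fun i => L i) (fun i => by simpa [Finsupp.mapDomain_apply hinj] using hL i)
  have hne' : ∀ e, (L e).Nonempty := fun e => Finset.card_pos.1 (by have := hL e; omega)
  refine ⟨fun e => if h : e ∈ s then w ⟨e, h⟩ else (hne' e).choose, fun e => ?_, ?_⟩
  · by_cases h : e ∈ s
    · simpa [h] using hw ⟨e, h⟩
    · simpa [h] using (hne' e).choose_spec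
  · rw [eval_rename]
    have : (fun e => if h : e ∈ s then w ⟨e, h⟩ else (hne' e).choose) ∘ Subtype.val = w := by
      ext i
      simp
    rwa [this]

end MvPolynomial.IsLeadingForm

/-! ### The difference product of the vertex sums of a complete graph -/

/-- The sum at the vertex `i` of the weights `x` on the edges of the complete graph with vertex set
`{0, …, m - 1}`. An edge is an unordered pair `s(i, j)`; the values of `x` at the diagonal pairs
`s(i, i)` are irrelevant. -/
def cliqueSum {R : Type*} [CommRing R] (x : Sym2 ℕ → R) (m i : ℕ) : R :=
  ∑ j ∈ (Finset.range m).erase i, x s(i, j)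

/-- The product of the differences `s i - s j` over all `j < i < m`. -/
def diffProd {R : Type*} [CommRing R] (s : ℕ → R) (m : ℕ) : R :=
  ∏ i ∈ Finset.range m, ∏ j ∈ Finset.range i, (s i - s j)

section
variable {R S : Type*} [CommRing R] [CommRing S]

theorem map_cliqueSum (φ : R →+* S) (x : Sym2 ℕ → R) (m i : ℕ) :
    φ (cliqueSum x m i) = cliqueSum (fun e => φ (x e)) m i := by
  simp [cliqueSum]

theorem map_diffProd (φ : R →+* S) (s : ℕ → R) (m : ℕ) :
    φ (diffProd s m) = diffProd (fun i => φ (s i)) m := by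
  simp [diffProd]

theorem diffProd_congr {s t : ℕ → R} {m : ℕ} (h : ∀ i ∈ Finset.range m, ∀ j ∈ Finset.range m,
    s i - s j = t i - t j) : diffProd s m = diffProd t m := by
  refine Finset.prod_congr rfl fun i hi => Finset.prod_congr rfl fun j hj => ?_
  refine h i hi j ?_
  simp only [Finset.mem_range] at *
  omega

theorem diffProd_succ (s : ℕ → R) (m : ℕ) :
    diffProd s (m + 1) = diffProd s m * ∏ j ∈ Finset.range m, (s m - s j) :=
  Finset.prod_range_succ _ _

theorem cliqueSum_succ (x : Sym2 ℕ → R) {m i : ℕ} (h : i < m) :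
    cliqueSum x (m + 1) i = cliqueSum x m i + x s(i, m) := by
  rw [cliqueSum, Finset.range_add_one, Finset.erase_insert_of_ne (by omega),
    Finset.sum_insert (by simp), add_comm]
  rfl

theorem cliqueSum_succ_self (x : Sym2 ℕ → R) (m : ℕ) :
    cliqueSum x (m + 1) m = ∑ j ∈ Finset.range m, x s(m, j) := by
  rw [cliqueSum, Finset.range_add_one, Finset.erase_insert (by simp)]

theorem cliqueSum_add (x : Sym2 ℕ → R) (c : R) {m i : ℕ} (h : i < m) :
    cliqueSum (fun e => x e + c) m i = cliqueSum x m i + ((m - 1 : ℕ) : R) * c := by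
  simp [cliqueSum, Finset.sum_add_distrib, Finset.card_erase_of_mem (Finset.mem_range.2 h)]

theorem isHomogeneous_cliqueSum (m i : ℕ) {σ : Type*} {x : Sym2 ℕ → MvPolynomial σ R}
    (hx : ∀ e, (x e).IsHomogeneous 1) : (cliqueSum x m i).IsHomogeneous 1 :=
  IsHomogeneous.sum _ _ _ fun _ _ => hx _

end

/-- The product of the differences of the vertex sums of the complete graph with vertex set
`{0, …, m - 1}`, whose edge weights are independent variables. -/
noncomputable def cliquePoly (m : ℕ) : MvPolynomial (Sym2 ℕ) ℝ := diffProd (cliqueSum X m) m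

theorem cliqueSum_mem_supported {m i : ℕ} (hi : i < m) :
    cliqueSum (X : Sym2 ℕ → MvPolynomial (Sym2 ℕ) ℝ) m i ∈
      supported ℝ {e : Sym2 ℕ | ∀ k ∈ e, k < m} := by
  refine Subalgebra.sum_mem (supported ℝ {e : Sym2 ℕ | ∀ k ∈ e, k < m}) fun j hj => ?_
  have hij : s(i, j) ∈ {e : Sym2 ℕ | ∀ k ∈ e, k < m} := by
    simp only [Finset.mem_erase, Finset.mem_range] at hj
    simp [hi, hj.2]
  exact X_mem_supported.2 hij

theorem cliquePoly_mem_supported (m : ℕ) :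
    cliquePoly m ∈ supported ℝ {e : Sym2 ℕ | ∀ k ∈ e, k < m} := by
  rw [cliquePoly, diffProd]
  refine Subalgebra.prod_mem _ fun i hi => Subalgebra.prod_mem _ fun j hj => ?_
  simp only [Finset.mem_range] at hi hj
  exact Subalgebra.sub_mem _ (cliqueSum_mem_supported hi) (cliqueSum_mem_supported (hj.trans hi))

theorem aeval_cliquePoly {A : Type*} [CommRing A] [Algebra ℝ A] (x : Sym2 ℕ → A) (m : ℕ) :
    aeval x (cliquePoly m) = diffProd (cliqueSum x m) m := by
  have h := map_diffProd (aeval x : MvPolynomial (Sym2 ℕ) ℝ →ₐ[ℝ] A).toRingHom (cliqueSum X m) m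
  simp only [map_cliqueSum] at h
  simpa [cliquePoly] using h

/-- `cliquePoly m` contains a monomial in which every variable has exponent at most two. -/
def HasSmallMonomial (m : ℕ) : Prop :=
  ∃ a : Sym2 ℕ →₀ ℕ, coeff a (cliquePoly m) ≠ 0 ∧ ∀ e, a e ≤ 2

theorem hasSmallMonomial_one : HasSmallMonomial 1 :=
  ⟨0, by simp [cliquePoly, diffProd], by simp⟩

/-- The monomial `p² q² r²` on the path with edges `p = s(0, 1)`, `q = s(0, 2)`, `r = s(2, 3)`
occurs: if all other variables are set to zero, `cliquePoly 4` becomes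
`q² (p - r)⁴ - q⁴ (p - r)²`. -/
theorem hasSmallMonomial_four : HasSmallMonomial 4 := by
  classical
  let K : Finset (Sym2 ℕ) := {s(0, 1), s(0, 2), s(2, 3)}
  let x : Sym2 ℕ → MvPolynomial (Sym2 ℕ) ℝ := fun e => if e ∈ (K : Set (Sym2 ℕ)) then X e else 0
  set p : MvPolynomial (Sym2 ℕ) ℝ := X s(0, 1) with hp
  set q : MvPolynomial (Sym2 ℕ) ℝ := X s(0, 2) with hq
  set r : MvPolynomial (Sym2 ℕ) ℝ := X s(2, 3) with hr
  have hV : aeval x (cliquePoly 4) =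
      q ^ 2 * (p - r) ^ 4 - q ^ 4 * (p - r) ^ 2 := by
    have e0 : cliqueSum x 4 0 = p + q := by
      rw [cliqueSum, show (Finset.range 4).erase 0 = {1, 2, 3} from rfl]
      simp [x, K, p, q]
    have e1 : cliqueSum x 4 1 = p := by
      rw [cliqueSum, show (Finset.range 4).erase 1 = {0, 2, 3} from rfl]
      simp [x, K, p]
    have e2 : cliqueSum x 4 2 = q + r := by
      rw [cliqueSum, show (Finset.range 4).erase 2 = {0, 1, 3} from rfl]
      simp [x, K, q, r]
    have e3 : cliqueSum x 4 3 = r := by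
      rw [cliqueSum, show (Finset.range 4).erase 3 = {0, 1, 2} from rfl]
      simp [x, K, r]
    rw [aeval_cliquePoly]
    simp only [diffProd, Finset.prod_range_succ, Finset.prod_range_zero, e0, e1, e2, e3]
    ring
  let b : Sym2 ℕ →₀ ℕ := Finsupp.single s(0, 1) 2 + Finsupp.single s(2, 3) 2
  have hne : coeff (Finsupp.single s(0, 2) 2 + b) (aeval x (cliquePoly 4)) ≠ 0 := by
    have hlin : p - r = Finsupp.linearCombination ℝ X
        (Finsupp.single s(0, 1) (1 : ℝ) + Finsupp.single s(2, 3) (-1)) := by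
      simp [p, r, sub_eq_add_neg]
    rw [hV, coeff_sub, hq, X_pow_eq_monomial, X_pow_eq_monomial, coeff_monomial_mul,
      coeff_monomial_mul', if_neg, hlin, coeff_linearCombination_X_pow, if_pos]
    · rw [sub_zero, one_mul]
      refine mul_ne_zero (Nat.cast_ne_zero.2 (Nat.multinomial_pos _ _).ne') ?_
      refine Finset.prod_ne_zero_iff.2 fun e he => pow_ne_zero _ ?_
      by_cases h1 : e = s(0, 1)
      · simp [h1]
      · by_cases h2 : e = s(2, 3)
        · simp [h2]
        · simp [b, h1, h2] at he
    · simp [b, Finsupp.sum_add_index']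
    · intro h
      have := h s(0, 2)
      simp [b] at this
  obtain ⟨m, hm, hmb⟩ := exists_coeff_ne_zero_of_coeff_restrict_ne_zero _ hne
  refine ⟨m, hm, fun e => (hmb e).trans ?_⟩
  by_cases he : e ∈ (K : Set (Sym2 ℕ))
  · have : e = s(0, 1) ∨ e = s(0, 2) ∨ e = s(2, 3) := by simpa [K] using he
    rw [if_pos he]
    rcases this with rfl | rfl | rfl <;> simp [b]
  · simp [he]


/-- The polynomial in question is `-2 Y (Z² - Y²) ^ (k + 1)`, whose part of degree two in `Z` is a
nonzero multiple of `Z² Y ^ (2 k + 1)`; all monomials of the power of `Y = ∑ X i` occur. -/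
theorem coeff_sq_sub_sq_ne_zero {σ : Type*} {S : Finset σ} {z : σ} (hz : z ∉ S) (k : ℕ)
    {c : σ →₀ ℕ} (hc : c.support ⊆ S) (hd : c.degree = 2 * k + 1)
    {Y Z : MvPolynomial σ ℝ} (hY : Y = ∑ i ∈ S, X i) (hZ : Z = X z) :
    coeff (Finsupp.single z 2 + c)
      ((Y + Z) ^ (k + 1) * ((-Y + Z) ^ (k + 1) * (-2 * Y))) ≠ 0 := by
  classical
  obtain ⟨K, hK⟩ := Polynomial.powAddExpansion (-Y ^ 2) (Z ^ 2) (k + 1)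
  have hexp : (Y + Z) ^ (k + 1) * ((-Y + Z) ^ (k + 1) * (-2 * Y)) =
      C (-2 * (-1) ^ (k + 1)) * Y ^ (2 * k + 3) +
      C (-2 * ((k : ℝ) + 1) * (-1) ^ k) * (Z ^ 2 * Y ^ (2 * k + 1)) + Z ^ 4 * (-2 * Y * K) := by
    rw [← mul_assoc, ← mul_pow, show (Y + Z) * (-Y + Z) = -Y ^ 2 + Z ^ 2 by ring, hK]
    simp only [map_mul, map_neg, map_pow, map_add, map_one, map_ofNat, map_natCast,
      Nat.add_sub_cancel, neg_pow (Y ^ 2), ← pow_mul]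
    push_cast
    ring
  have hcz : c z = 0 := Finsupp.notMem_support_iff.1 fun h => hz (hc h)
  have hYs : Y ∈ supported ℝ ({z} : Set σ)ᶜ := by
    rw [hY]
    exact Subalgebra.sum_mem _ fun i hi => X_mem_supported.2 (by rintro rfl; exact hz hi)
  rw [hexp, coeff_add, coeff_add, coeff_C_mul, coeff_C_mul,
    coeff_eq_zero_of_mem_supported (Subalgebra.pow_mem _ hYs _) (Set.mem_singleton z) (by simp),
    hZ, X_pow_eq_monomial, X_pow_eq_monomial, coeff_monomial_mul, coeff_monomial_mul', if_neg, hY,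
    ← hd]
  · have := coeff_sum_X_pow_ne_zero (R := ℝ) S c hc
    simp only [mul_zero, zero_add, one_mul, add_zero]
    refine mul_ne_zero (mul_ne_zero (mul_ne_zero (by norm_num) (by positivity)) (by simp)) this
  · intro h
    have := h z
    simp [hcz] at this

theorem exists_le_two_degree_eq {σ : Type*} (S : Finset σ) {k : ℕ} (hS : S.card = k + 1) :
    ∃ c : σ →₀ ℕ, c.support ⊆ S ∧ c.degree = 2 * k + 1 ∧ ∀ e, c e ≤ 2 := by
  classical
  obtain ⟨e₀, he₀⟩ : S.Nonempty := Finset.card_pos.1 (by omega)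
  refine ⟨Finsupp.indicator S fun e _ => if e = e₀ then 1 else 2,
    Finsupp.support_indicator_subset _ _, ?_, fun e => ?_⟩
  · rw [Finsupp.degree_apply,
      Finset.sum_subset (Finsupp.support_indicator_subset S _)
        fun e _ he => Finsupp.notMem_support_iff.1 he,
      ← Finset.add_sum_erase _ _ he₀, Finset.sum_congr rfl (g := fun _ => 2)]
    · simp [Finsupp.indicator_of_mem he₀, Finset.card_erase_of_mem he₀, hS]
      omega
    · intro e he
      simp [Finsupp.indicator_of_mem (Finset.mem_of_mem_erase he), Finset.ne_of_mem_erase he]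
  · simp only [Finsupp.indicator_apply]
    split_ifs <;> omega

/-- Two vertices `m`, `m + 1` are joined to a clique on `m` vertices. The substitution of
`-X s(i, m)` for `X s(i, m + 1)` leaves the sums at the old vertices unchanged and turns the sums at
the new ones into `Y + Z` and `-Y + Z`, where `Z` is the variable of the new edge and `Y` is the sum
of the variables `X s(i, m)`. So `cliquePoly (m + 2)` becomes the product of `cliquePoly m` and a
form `Q` of degree `2 * m + 1`. The part of `Q` free of old variables is `-2 Y (Z² - Y²) ^ m`, which
contains `Z²` times any monomial of degree `2 * m - 1` in the `m` variables of `Y`. -/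
theorem hasSmallMonomial_add_two {m : ℕ} (hm : 1 ≤ m) (h : HasSmallMonomial m) :
    HasSmallMonomial (m + 2) := by
  classical
  obtain ⟨a, ha, ha2⟩ := h
  -- Edges from `m + 1` to vertices other than `m` are moved to the corresponding edges from `m`.
  let f : Sym2 ℕ → Sym2 ℕ := fun e =>
    if m + 1 ∈ e ∧ m ∉ e then Sym2.map (Equiv.swap m (m + 1)) e else e
  let x : Sym2 ℕ → MvPolynomial (Sym2 ℕ) ℝ := fun e =>
    if m + 1 ∈ e ∧ m ∉ e then -X (f e) else X (f e)
  have x_old : ∀ i < m, ∀ j < m, x s(i, j) = X s(i, j) := by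
    intro i hi j hj
    have : ¬ (m + 1 ∈ s(i, j) ∧ m ∉ s(i, j)) := by simp; omega
    simp only [x, f, if_neg this]
  have x_left : ∀ i, x s(i, m) = X s(i, m) := by
    intro i
    have : ¬ (m + 1 ∈ s(i, m) ∧ m ∉ s(i, m)) := by simp
    simp only [x, f, if_neg this]
  have x_right : ∀ i < m, x s(i, m + 1) = -X s(i, m) := by
    intro i hi
    have : m + 1 ∈ s(i, m + 1) ∧ m ∉ s(i, m + 1) := by simp; omega
    simp only [x, f, if_pos this]
    rw [Sym2.map_mk, Equiv.swap_apply_right, Equiv.swap_apply_of_ne_of_ne] <;> omega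
  set Y : MvPolynomial (Sym2 ℕ) ℝ := ∑ j ∈ Finset.range m, X s(m, j) with hY
  set Z : MvPolynomial (Sym2 ℕ) ℝ := X s(m + 1, m) with hZ
  have s_old : ∀ i < m, cliqueSum x (m + 2) i = cliqueSum X m i := by
    intro i hi
    rw [cliqueSum_succ x (by omega), cliqueSum_succ x hi, x_left, x_right i hi,
      add_neg_cancel_right]
    refine Finset.sum_congr rfl fun j hj => x_old i hi j ?_
    simpa using (Finset.mem_erase.1 hj).2
  have s_left : cliqueSum x (m + 2) m = Y + Z := by
    rw [cliqueSum_succ x (by omega), cliqueSum_succ_self, Sym2.eq_swap, x_left]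
    congr 1
    exact Finset.sum_congr rfl fun j hj => by rw [Sym2.eq_swap, x_left]
  have s_right : cliqueSum x (m + 2) (m + 1) = -Y + Z := by
    rw [cliqueSum_succ_self, Finset.sum_range_succ, x_left, hY, ← Finset.sum_neg_distrib]
    congr 1
    refine Finset.sum_congr rfl fun j hj => ?_
    rw [Sym2.eq_swap, x_right j (Finset.mem_range.1 hj), Sym2.eq_swap]
  let Q : MvPolynomial (Sym2 ℕ) ℝ := (∏ j ∈ Finset.range m, (Y + Z - cliqueSum X m j)) *
    ((∏ j ∈ Finset.range m, (-Y + Z - cliqueSum X m j)) * (-Y + Z - (Y + Z)))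
  have hfact : aeval x (cliquePoly (m + 2)) = cliquePoly m * Q := by
    have hprod : ∀ A : MvPolynomial (Sym2 ℕ) ℝ,
        ∏ j ∈ Finset.range m, (A - cliqueSum x (m + 2) j) =
          ∏ j ∈ Finset.range m, (A - cliqueSum X m j) := fun A =>
      Finset.prod_congr rfl fun j hj => by rw [s_old j (Finset.mem_range.1 hj)]
    have hdiff : diffProd (cliqueSum x (m + 2)) m = cliquePoly m :=
      diffProd_congr fun i hi j hj => by
        rw [s_old i (Finset.mem_range.1 hi), s_old j (Finset.mem_range.1 hj)]
    rw [aeval_cliquePoly, diffProd_succ, diffProd_succ, Finset.prod_range_succ, s_left, s_right,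
      hprod, hprod, hdiff, mul_assoc]
  have hQ : Q.IsHomogeneous (m + (m + 1)) := by
    have hYh : Y.IsHomogeneous 1 := IsHomogeneous.sum _ _ _ fun _ _ => isHomogeneous_X _ _
    have hZh : Z.IsHomogeneous 1 := isHomogeneous_X _ _
    have hS : ∀ j, (cliqueSum X m j : MvPolynomial (Sym2 ℕ) ℝ).IsHomogeneous 1 := fun j =>
      isHomogeneous_cliqueSum m j fun e => isHomogeneous_X _ _
    have hprod : ∀ A : MvPolynomial (Sym2 ℕ) ℝ, A.IsHomogeneous 1 →
        (∏ j ∈ Finset.range m, (A - cliqueSum X m j)).IsHomogeneous m := by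
      intro A hA
      have := IsHomogeneous.prod (Finset.range m) (fun j => A - cliqueSum X m j) (fun _ => 1)
        fun j _ => hA.sub (hS j)
      simpa using this
    have h1 := hYh.add hZh
    have h2 := hYh.neg.add hZh
    have h3 := h2.sub h1
    have h4 := hprod _ h1
    have h5 := hprod _ h2
    have h6 := h5.mul h3
    exact h4.mul h6
  let T : Set (Sym2 ℕ) := {e | m ∈ e}
  have hP : cliquePoly m ∈ supported ℝ Tᶜ := by
    refine supported_mono ?_ (cliquePoly_mem_supported m)
    exact fun e he hm => (he m hm).false
  have hQ0 : aeval (fun t => if t ∈ T then (X t : MvPolynomial (Sym2 ℕ) ℝ) else 0) Q =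
      (Y + Z) ^ m * ((-Y + Z) ^ m * (-2 * Y)) := by
    have hY0 : aeval (fun t => if t ∈ T then (X t : MvPolynomial (Sym2 ℕ) ℝ) else 0) Y = Y := by
      simp [hY, T]
    have hZ0 : aeval (fun t => if t ∈ T then (X t : MvPolynomial (Sym2 ℕ) ℝ) else 0) Z = Z := by
      simp [hZ, T]
    have hS0 : ∀ j < m, aeval (fun t => if t ∈ T then (X t : MvPolynomial (Sym2 ℕ) ℝ) else 0)
        (cliqueSum X m j : MvPolynomial (Sym2 ℕ) ℝ) = 0 := by
      intro j hj
      rw [cliqueSum, map_sum]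
      refine Finset.sum_eq_zero fun i hi => ?_
      rw [aeval_X]
      have : ¬ (m = j ∨ m = i) := by
        have := (Finset.mem_erase.1 hi).2
        rw [Finset.mem_range] at this
        omega
      simp [T, this]
    have hprod : ∀ A : MvPolynomial (Sym2 ℕ) ℝ,
        aeval (fun t => if t ∈ T then (X t : MvPolynomial (Sym2 ℕ) ℝ) else 0) A = A →
        aeval (fun t => if t ∈ T then (X t : MvPolynomial (Sym2 ℕ) ℝ) else 0)
          (∏ j ∈ Finset.range m, (A - cliqueSum X m j)) = A ^ m := by
      intro A hA
      rw [map_prod, Finset.prod_congr rfl (g := fun _ => A)]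
      · simp
      · intro j hj
        rw [map_sub, hA, hS0 j (Finset.mem_range.1 hj), sub_zero]
    simp only [Q]
    rw [map_mul, map_mul, hprod _ (by rw [map_add, hY0, hZ0]),
      hprod _ (by rw [map_add, map_neg, hY0, hZ0]), map_sub, map_add, map_add, map_neg, hY0, hZ0]
    ring
  let S : Finset (Sym2 ℕ) := (Finset.range m).image fun j => s(m, j)
  have hinj : Set.InjOn (fun j => s(m, j)) (Finset.range m : Set ℕ) := by
    intro i hi j hj hij
    exact Sym2.congr_right.1 hij
  -- A monomial of degree `2 * m - 1` in the `m` variables of `Y`, with exponents at most two.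
  obtain ⟨k, rfl⟩ := Nat.exists_eq_add_of_le' hm
  obtain ⟨c, hcS, hdeg, hc2⟩ := exists_le_two_degree_eq S (k := k)
    (by rw [Finset.card_image_of_injOn hinj, Finset.card_range])
  have hzS : s(k + 1 + 1, k + 1) ∉ S := by
    simp [S]
  have hb := coeff_sq_sub_sq_ne_zero hzS k hcS hdeg (Y := Y) (Z := Z)
    (by rw [Finset.sum_image hinj]) rfl
  rw [← hQ0] at hb
  obtain ⟨b, hb, hbc⟩ := exists_coeff_mul_ne_zero_of_supported T hP hQ ha hb
  rw [← hfact] at hb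
  obtain ⟨p, hp, hpb⟩ := exists_coeff_ne_zero_of_coeff_aeval_ne_zero x (fun e => {f e}) (by
    intro e p hp
    have : p ∈ (X (f e) : MvPolynomial (Sym2 ℕ) ℝ).support := by
      by_cases he : k + 1 + 1 ∈ e ∧ k + 1 ∉ e
      · simpa only [x, if_pos he, support_neg] using hp
      · simpa only [x, if_neg he] using hp
    rw [support_X, Finset.mem_singleton] at this
    simp [this]) hb
  refine ⟨p, hp, fun e => (hpb e).trans ?_⟩
  rw [Finset.sum_singleton]
  refine (hbc _).trans ?_
  split_ifs
  · by_cases hz : f e = s(k + 1 + 1, k + 1)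
    · have : c (f e) = 0 := Finsupp.notMem_support_iff.1 fun h => hzS (hz ▸ hcS h)
      rw [Finsupp.add_apply, this, hz, Finsupp.single_eq_same]
    · rw [Finsupp.add_apply, Finsupp.single_eq_of_ne hz, zero_add]
      exact hc2 _
  · exact ha2 _

theorem hasSmallMonomial {n : ℕ} (hn : 3 ≤ n) : HasSmallMonomial n := by
  induction n using Nat.strong_induction_on with
  | _ n ih =>
    obtain rfl | rfl | h : n = 3 ∨ n = 4 ∨ 5 ≤ n := by omega
    · exact hasSmallMonomial_add_two le_rfl hasSmallMonomial_one
    · exact hasSmallMonomial_four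
    · obtain ⟨m, rfl⟩ := Nat.exists_eq_add_of_le' (show 2 ≤ n by omega)
      exact hasSmallMonomial_add_two (by omega) (ih m (by omega) (by omega))

/-! ### Weights on a complete graph with forbidden vertex sums -/

/-- The substitution of `X e + W` for every variable `X e` does not affect `cliquePoly n`, and it
adds `(n - 1) * W` to each vertex sum. The monomial is found in the coefficient of the highest
power of `W`, which is a nonzero multiple of `cliquePoly n`. -/
theorem exists_coeff_cliquePoly_mul_prod_ne_zero {n : ℕ} (hn : 3 ≤ n) (d : ℕ → ℕ) :
    ∃ a : Sym2 ℕ →₀ ℕ,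
      coeff a (cliquePoly n * ∏ i ∈ Finset.range n, cliqueSum X n i ^ d i) ≠ 0 ∧
      ∀ e, a e ≤ 2 + ∑ i ∈ Finset.range n, d i := by
  classical
  obtain ⟨a, ha, ha2⟩ := hasSmallMonomial hn
  set N := ∑ i ∈ Finset.range n, d i with hN
  let y : Sym2 ℕ → MvPolynomial (Option (Sym2 ℕ)) ℝ := fun e => X (some e)
  let W : MvPolynomial (Option (Sym2 ℕ)) ℝ := X none
  let x : Sym2 ℕ → MvPolynomial (Option (Sym2 ℕ)) ℝ := fun e => y e + W
  let Q : MvPolynomial (Option (Sym2 ℕ)) ℝ :=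
    ∏ i ∈ Finset.range n, (cliqueSum y n i + ((n - 1 : ℕ) : MvPolynomial _ ℝ) * W) ^ d i
  let T : Set (Option (Sym2 ℕ)) := {none}
  have hfact : aeval x (cliquePoly n * ∏ i ∈ Finset.range n, cliqueSum X n i ^ d i) =
      rename some (cliquePoly n) * Q := by
    rw [map_mul, map_prod]
    have hren : (rename some : MvPolynomial (Sym2 ℕ) ℝ →ₐ[ℝ] _) = aeval y :=
      algHom_ext fun e => by simp [y]
    have h1 : aeval x (cliquePoly n) = rename some (cliquePoly n) := by
      rw [hren, aeval_cliquePoly, aeval_cliquePoly]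
      refine diffProd_congr fun i hi j hj => ?_
      rw [cliqueSum_add y W (Finset.mem_range.1 hi), cliqueSum_add y W (Finset.mem_range.1 hj),
        add_sub_add_right_eq_sub]
    have h2 : ∀ i ∈ Finset.range n, aeval x ((cliqueSum X n i : MvPolynomial (Sym2 ℕ) ℝ) ^ d i) =
        (cliqueSum y n i + ((n - 1 : ℕ) : MvPolynomial _ ℝ) * W) ^ d i := by
      intro i hi
      rw [← cliqueSum_add y W (Finset.mem_range.1 hi), map_pow]
      simp [cliqueSum, x]
    rw [h1, Finset.prod_congr rfl h2]
  have hP : rename some (cliquePoly n) ∈ supported ℝ Tᶜ := by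
    rw [mem_supported]
    intro e he
    obtain ⟨e', -, rfl⟩ := Finset.mem_image.1 (vars_rename _ _ he)
    simp [T]
  have ha' : coeff (a.mapDomain some) (rename some (cliquePoly n)) ≠ 0 := by
    rwa [coeff_rename_mapDomain _ (Option.some_injective _)]
  have hQ : Q.IsHomogeneous N := by
    refine IsHomogeneous.prod _ _ _ fun i _ => ?_
    have h1 : (cliqueSum y n i).IsHomogeneous 1 :=
      isHomogeneous_cliqueSum n i fun e => isHomogeneous_X _ _
    have h2 := (h1.add (isHomogeneous_C_mul_X ((n - 1 : ℕ) : ℝ) none)).pow (d i)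
    simpa [W] using h2
  have hb : coeff (Finsupp.single none N)
      (aeval (fun t => if t ∈ T then (X t : MvPolynomial (Option (Sym2 ℕ)) ℝ) else 0) Q) ≠ 0 := by
    have : aeval (fun t => if t ∈ T then (X t : MvPolynomial (Option (Sym2 ℕ)) ℝ) else 0) Q =
        monomial (Finsupp.single none N) (((n - 1 : ℕ) : ℝ) ^ N) := by
      rw [← C_mul_X_pow_eq_monomial, map_pow, ← mul_pow, hN, ← Finset.prod_pow_eq_pow_sum, map_prod]
      refine Finset.prod_congr rfl fun i _ => ?_
      have : aeval (fun t => if t ∈ T then (X t : MvPolynomial (Option (Sym2 ℕ)) ℝ) else 0)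
          (cliqueSum y n i) = 0 := by
        simp [cliqueSum, y, T]
      rw [map_pow, map_add, this, map_mul]
      simp [W, T]
    rw [this, coeff_monomial, if_pos rfl]
    exact pow_ne_zero _ (Nat.cast_ne_zero.2 (by omega))
  obtain ⟨b, hb, hbc⟩ := exists_coeff_mul_ne_zero_of_supported T hP hQ ha' hb
  rw [← hfact] at hb
  obtain ⟨p, hp, hpb⟩ := exists_coeff_ne_zero_of_coeff_aeval_ne_zero x
    (fun e => {some e, none}) (by
      intro e p hp
      rcases Finset.mem_union.1 (support_add hp) with h | h <;>
      · simp only [y, W, support_X, Finset.mem_singleton] at h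
        simp [h]) hb
  refine ⟨p, hp, fun e => (hpb e).trans ?_⟩
  rw [Finset.sum_pair (by simp)]
  refine add_le_add ((hbc _).trans ?_) ((hbc _).trans ?_)
  · simpa [T, Finsupp.mapDomain_apply (Option.some_injective _)] using ha2 e
  · simp [T]

/-- The edges of a complete graph can be weighted from lists of size `n * d + 3` in such a way that
the vertex sums, shifted by given constants `c i`, are distinct and avoid at most `d` given values
at each vertex. -/
theorem exists_weights_cliqueSum {n d : ℕ} (hn : 3 ≤ n) (L : Sym2 ℕ → Finset ℝ)
    (hL : ∀ e, n * d + 3 ≤ (L e).card) (c : ℕ → ℝ) (B : ℕ → Finset ℝ)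
    (hB : ∀ i < n, (B i).card ≤ d) :
    ∃ w : Sym2 ℕ → ℝ, (∀ e, w e ∈ L e) ∧
      (∀ i < n, ∀ j < n, i ≠ j → cliqueSum w n i + c i ≠ cliqueSum w n j + c j) ∧
      ∀ i < n, cliqueSum w n i + c i ∉ B i := by
  classical
  obtain ⟨a, ha, ha2⟩ := exists_coeff_cliquePoly_mul_prod_ne_zero hn fun i => (B i).card
  have hS : ∀ i, (cliqueSum X n i : MvPolynomial (Sym2 ℕ) ℝ).IsHomogeneous 1 := fun i =>
    isHomogeneous_cliqueSum n i fun e => isHomogeneous_X _ _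
  have h1 := IsLeadingForm.prod (Finset.range n) fun i _ =>
    IsLeadingForm.prod (Finset.range i) fun j _ =>
      IsLeadingForm.add_C ((hS i).sub (hS j)) (c i - c j)
  have h2 := IsLeadingForm.prod (Finset.range n) fun i _ =>
    IsLeadingForm.prod (B i) fun b _ => IsLeadingForm.add_C (hS i) (c i - b)
  have h3 := h1.mul h2
  simp only [Finset.prod_const] at h3
  obtain ⟨w, hw, hne⟩ := h3.exists_eval_ne_zero ha L (by
    intro e
    have h4 : ∑ i ∈ Finset.range n, (B i).card ≤ n * d := by
      simpa using Finset.sum_le_card_nsmul (Finset.range n) _ d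
        fun i hi => hB i (Finset.mem_range.1 hi)
    have := ha2 e
    have := hL e
    omega)
  have heval : ∀ i, eval w (cliqueSum X n i) = cliqueSum w n i := fun i => by simp [cliqueSum]
  rw [map_mul, map_prod, map_prod] at hne
  simp only [map_prod, map_add, map_sub, heval, eval_C] at hne
  have hne1 := Finset.prod_ne_zero_iff.1 (left_ne_zero_of_mul hne)
  have hne2 := Finset.prod_ne_zero_iff.1 (right_ne_zero_of_mul hne)
  have hlt : ∀ i < n, ∀ j < i, cliqueSum w n i + c i ≠ cliqueSum w n j + c j := by
    intro i hi j hj h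
    refine Finset.prod_ne_zero_iff.1 (hne1 i (Finset.mem_range.2 hi)) j (Finset.mem_range.2 hj) ?_
    linarith
  refine ⟨w, hw, fun i hi j hj hij => ?_, fun i hi hmem => ?_⟩
  · rcases lt_or_gt_of_ne hij with h | h
    · exact (hlt j hj i h).symm
    · exact hlt i hi j h
  · refine Finset.prod_ne_zero_iff.1 (hne2 i (Finset.mem_range.2 hi)) _ hmem ?_
    ring

end

/-! ### Cartesian products with complete graphs -/

namespace SimpleGraph

open Classical in
theorem weightSum_eq_sum_adj {V : Type*} [Fintype V] (G : SimpleGraph V) (W : Sym2 V → ℝ) (v : V) :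
    G.weightSum (fun e => W e) v = ∑ u with G.Adj v u, W s(v, u) := by
  symm
  refine Finset.sum_bij (fun u hu => ⟨s(v, u), (Finset.mem_filter.1 hu).2⟩) ?_ ?_ ?_ ?_
  · simp
  · intro a _ b _ h
    exact Sym2.congr_right.1 (Subtype.ext_iff.1 h)
  · rintro ⟨e, he⟩ hv
    obtain ⟨u, rfl⟩ := Sym2.mem_iff_exists.1 (Finset.mem_filter.1 hv).2
    exact ⟨u, by simpa using he, rfl⟩
  · simp

/-- The copies of `Kₙ` over the vertices of `A` are treated one at a time. The sums at the copy over
`v` are adjusted by changing the weights inside that copy only, which affects no other sum; each of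
its vertices has at most `d` neighbours over the rest of `A`, whose sums have to be avoided. -/
theorem exists_forall_weightSum_ne {V : Type*} [Fintype V] {G : SimpleGraph V} {n d : ℕ}
    (hn : 3 ≤ n) (hG : G.IsDegenerate d) (L : Sym2 (V × Fin n) → Finset ℝ)
    (hL : ∀ e, n * d + 3 ≤ (L e).card) (A : Finset V) :
    ∃ W : Sym2 (V × Fin n) → ℝ, (∀ e, W e ∈ L e) ∧
      ∀ p q : V × Fin n, p.1 ∈ A → q.1 ∈ A → (G □ completeGraph (Fin n)).Adj p q →
        (G □ completeGraph (Fin n)).weightSum (fun e => W e) p ≠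
          (G □ completeGraph (Fin n)).weightSum (fun e => W e) q := by
  classical
  have : NeZero n := ⟨by omega⟩
  set H := G □ completeGraph (Fin n) with hH
  induction A using Finset.strongInduction with
  | H A ih =>
  obtain rfl | hA := A.eq_empty_or_nonempty
  · have hne : ∀ e, (L e).Nonempty := fun e => Finset.card_pos.1 (by have := hL e; omega)
    exact ⟨fun e => (hne e).choose, fun e => (hne e).choose_spec, by simp⟩
  obtain ⟨⟨v, hvA⟩, hv⟩ := hG (A : Set V) hA
  have hvA : v ∈ A := hvA
  obtain ⟨W, hWL, hW⟩ := ih _ (Finset.erase_ssubset hvA)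
  have hcard : (Finset.univ.filter fun u => u ∈ A ∧ G.Adj v u).card ≤ d := by
    have himg : Subtype.val '' ((G.induce (A : Set V)).neighborSet ⟨v, hvA⟩) =
        ((Finset.univ.filter fun u => u ∈ A ∧ G.Adj v u : Finset V) : Set V) := by
      ext u
      simp [and_comm]
    rw [← Subtype.val_injective.encard_image, himg, Set.encard_coe_eq_coe_finsetCard] at hv
    exact_mod_cast hv
  -- `f` and `g` identify the vertices `0, …, n - 1` of the clique with the copy of `Kₙ` over `v`.
  let f : ℕ → V × Fin n := fun i => (v, Fin.ofNat n i)
  let g : V × Fin n → ℕ := fun x => x.2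
  have hfg : ∀ x : V × Fin n, x.1 = v → f (g x) = x := by
    rintro ⟨_, i⟩ rfl
    simp [f, g]
  have hgf : ∀ i < n, g (f i) = i := fun i hi => by simp [f, g, Nat.mod_eq_of_lt hi]
  -- `c i` is the contribution of the edges that leave the copy over `v`.
  let c : ℕ → ℝ := fun i => ∑ x with H.Adj (f i) x ∧ x.1 ≠ v, W s(f i, x)
  let B : ℕ → Finset ℝ := fun i => (Finset.univ.filter fun u => u ∈ A ∧ G.Adj v u).image
    fun u => H.weightSum (fun e => W e) (u, Fin.ofNat n i)
  obtain ⟨w, hwL, hw, hwB⟩ := exists_weights_cliqueSum hn (fun e => L (e.map f))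
    (fun e => hL _) c B fun i _ => Finset.card_image_le.trans hcard
  let W' : Sym2 (V × Fin n) → ℝ := fun e => if ∀ x ∈ e, x.1 = v then w (e.map g) else W e
  have hW'L : ∀ e, W' e ∈ L e := by
    intro e
    by_cases he : ∀ x ∈ e, x.1 = v
    · have hmap : (e.map g).map f = e := by
        rw [Sym2.map_map, Sym2.map_congr (f := f ∘ g) (g := id) fun x hx => hfg x (he x hx),
          Sym2.map_id, id]
      simp only [W', if_pos he]
      simpa only [hmap] using hwL (e.map g)
    · simpa only [W', if_neg he] using hWL e
  have hnew : ∀ i : Fin n, H.weightSum (fun e => W' e) (v, i) = cliqueSum w n i + c i := by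
    intro i
    have hi : f i = (v, i) := hfg (v, i) rfl
    rw [weightSum_eq_sum_adj, ← Finset.sum_filter_add_sum_filter_not _ (fun x => x.1 = v),
      Finset.filter_filter, Finset.filter_filter]
    congr 1
    · symm
      refine Finset.sum_nbij' f g ?_ ?_ ?_ ?_ ?_
      · intro j hj
        rw [Finset.mem_erase, Finset.mem_range] at hj
        have hne : i ≠ Fin.ofNat n j := by
          rintro rfl
          exact hj.1 (hgf j hj.2).symm
        exact Finset.mem_filter.2 ⟨Finset.mem_univ _, Or.inr ⟨hne, rfl⟩, rfl⟩
      · rintro ⟨u, j⟩ hj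
        obtain ⟨hadj, rfl⟩ : H.Adj (v, i) (u, j) ∧ u = v := by simpa using hj
        rw [Finset.mem_erase, Finset.mem_range]
        refine ⟨fun h => hadj.ne ?_, j.2⟩
        rw [Fin.ext h.symm]
      · intro j hj
        rw [Finset.mem_erase, Finset.mem_range] at hj
        exact hgf j hj.2
      · intro x hx
        exact hfg x (Finset.mem_filter.1 hx).2.2
      · intro j hj
        rw [Finset.mem_erase, Finset.mem_range] at hj
        have : ∀ x ∈ s((v, i), f j), x.1 = v := by simp [f]
        simp only [W', if_pos this, Sym2.map_mk, hgf j hj.2]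
        rfl
    · simp only [c, hi]
      refine Finset.sum_congr rfl fun x hx => ?_
      have : ¬ ∀ y ∈ s((v, i), x), y.1 = v := fun h =>
        (Finset.mem_filter.1 hx).2.2 (h x (Sym2.mem_mk_right _ _))
      simp only [W', if_neg this]
  have hold : ∀ p : V × Fin n, p.1 ≠ v →
      H.weightSum (fun e => W' e) p = H.weightSum (fun e => W e) p := by
    intro p hp
    rw [weightSum_eq_sum_adj, weightSum_eq_sum_adj]
    refine Finset.sum_congr rfl fun x _ => ?_
    have : ¬ ∀ y ∈ s(p, x), y.1 = v := fun h => hp (h p (Sym2.mem_mk_left _ _))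
    simp only [W', if_neg this]
  have hmixed : ∀ (i : Fin n) (q : V × Fin n), q.1 ∈ A → q.1 ≠ v → H.Adj (v, i) q →
      H.weightSum (fun e => W' e) (v, i) ≠ H.weightSum (fun e => W' e) q := by
    rintro i ⟨u, j⟩ hu huv hadj
    obtain ⟨hvu, rfl⟩ : G.Adj v u ∧ i = j := by
      rcases hadj with h | h
      · exact h
      · exact absurd h.2.symm huv
    rw [hnew, hold _ huv]
    intro h
    refine hwB i i.2 (Finset.mem_image.2 ⟨u, ?_, ?_⟩)
    · simpa using ⟨hu, hvu⟩
    · simpa using h.symm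
  refine ⟨W', hW'L, ?_⟩
  rintro ⟨u, i⟩ ⟨u', j⟩ hu hu' hadj
  by_cases h1 : u = v <;> by_cases h2 : u' = v
  · subst h1
    subst h2
    rw [hnew, hnew]
    refine hw i i.2 j j.2 fun hij => hadj.ne ?_
    rw [Fin.ext hij]
  · subst h1
    exact hmixed i _ hu' h2 hadj
  · subst h2
    exact (hmixed j _ hu h1 hadj.symm).symm
  · rw [hold _ h1, hold _ h2]
    exact hW _ _ (Finset.mem_erase.2 ⟨h1, hu⟩) (Finset.mem_erase.2 ⟨h2, hu'⟩) hadj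

theorem IsDegenerate.isEdgeWeightChoosable_boxProd_completeGraph {V : Type*} [Fintype V]
    {G : SimpleGraph V} {n d : ℕ} (hn : 3 ≤ n) (hG : G.IsDegenerate d) :
    (G □ completeGraph (Fin n)).IsEdgeWeightChoosable (n * d + 3) := by
  classical
  intro L hL
  -- Pairs that are not edges receive an arbitrary list.
  obtain ⟨S, hS⟩ := Infinite.exists_subset_card_eq ℝ (n * d + 3)
  obtain ⟨W, hWL, hW⟩ := exists_forall_weightSum_ne hn hG
    (fun e => if h : e ∈ (G □ completeGraph (Fin n)).edgeSet then L ⟨e, h⟩ else S)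
    (fun e => by split_ifs with h; exacts [(hL _).ge, hS.ge]) Finset.univ
  refine ⟨fun e => W e, fun e => ?_, fun p q => hW p q (Finset.mem_univ _) (Finset.mem_univ _)⟩
  simpa using hWL e

end SimpleGraph

theorem mainTheorem6 {V : Type*} [Fintype V] (G : SimpleGraph V) (n d : ℕ) (hn : 3 ≤ n)
    (hG : G.IsDegenerate d) :
    (SimpleGraph.boxProd G (SimpleGraph.completeGraph (Fin n))).edgeWeightChoosability
      ≤ ((n * d + 3 : ℕ) : ℕ∞) :=
  iInf₂_le _ (hG.isEdgeWeightChoosable_boxProd_completeGraph hn)
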